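/- **Theorem 3.3.** Fix an algebraic closure $\overline{\mathbb Q}$ of $\mathbb Q$. For a number field $L$ and a place $v$ of $L$ lying over the place $p$ of $\mathbb Q$, let $\|\cdot\|_v$ be the absolute value on the completion $L_v$ extending the usual absolute value on $\mathbb Q_p$, and put $|x|_v=\|x\|_v^{[L_v:\mathbb Q_p]/[L:\mathbb Q]}$. The (logarithmic) Weil height of $x\in\overline{\mathbb Q}$ is $h(x)=\sum_v\log\max\{1,|x|_v\}$, where $v$ runs over all places of a number field $L$ containing $x$ (the value is independent of $L$). For a number field $K\subset\overline{\mathbb Q}$ and $x\in\overline{\mathbb Q}$ put $m_K(x)=[K(x):K]\cdot h(x)$. The field $K$ is called *balanced* if for every non-zero $x\in\mathcal O_K$ there is a unit $u\in\mathcal O_K^\times$ such that $|ux|_v\ge 1$ for all Archimedean places $v$ of $K$. Let $K\subset\overline{\mathbb Q}$ be a balanced number field of class number $\lambda$. Let $\alpha\in K^\times$ and let $\alpha_1,\dots,\alpha_N\in\overline{\mathbb Q}$ be such that $\alpha=\alpha_1\alpha_2\cdots\alpha_N$. Then there exist $\gamma_0,\gamma_1,\dots,\gamma_N\in\overline{\mathbb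 Q}$ such that 1. $\alpha=\gamma_0\gamma_1\cdots\gamma_N$; 2. $\gamma_0$ is a unit in the ring of algebraic integers; 3. $\gamma_n^\lambda\in K$ for all $0\le n\le N$; 4. $h(\gamma_n)\le m_K(\alpha_n)$ for all $1\le n\le N$. -/

import Mathlib

open scoped NumberField IntermediateField

/-- A number field `K` is balanced if for every non-zero algebraic integer `x` of `K` there is a
unit `u` of the ring of integers of `K` with `|u x|_v ≥ 1` at every Archimedean place `v` of `K`.
(Here `v` is the unnormalized absolute value; the normalized one is a positive power of it, so the
condition is the same.) -/
def IsBalanced (K : Type*) [Field K] [NumberField K] : Prop :=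
  ∀ x : 𝓞 K, x ≠ 0 → ∃ u : (𝓞 K)ˣ, ∀ v : NumberField.InfinitePlace K,
    1 ≤ v (((u : 𝓞 K) : K) * (x : K))

/-- The Mahler measure over `K` of an algebraic number: `m_K(x) = [K(x) : K] · h(x)`, where
`h(x) = ∑_v log max(1, |x|_v)` is the absolute logarithmic Weil height, the sum being over the places
of the number field `L = ℚ(x)` and the absolute values being normalized with exponent
`[L_v : ℚ_v] / [L : ℚ]`. -/
noncomputable def mahlerMeasureOver (K : Type*) [Field K] {Ω : Type*} [Field Ω] [CharZero Ω]
    [Algebra K Ω] (x : Ω) : ℝ :=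
  (Module.finrank K K⟮x⟯ : ℝ) * NumberField.absLogHeight₁ x

/-! Let `x n` be the norm of `a n` from `K⟮a n⟯` to `K`. It is a product of `[K(a n) : K]`
conjugates of equal height, so its height is at most `mahlerMeasureOver K (a n)`. Norms from the
field `E` generated by all `a n` give `α ^ D = ∏ x n ^ k n` with `k n = [E : K(a n)] ≤ D = [E : K]`
(`exists_pow_eq_prod_norm_gen_pow`). Hence the numerator ideal of `α` divides the product of those
of the `x n`, so it splits into ideals `A n` dividing them; the denominators give `B n` likewise.
With λ the class number, `A n ^ λ` and `B n ^ λ` are principal, and suitable quotients `β n` of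
their generators multiply to `α ^ λ` up to a unit. Balancedness makes generators of the λ-th powers
of the cofactors have size at least 1 at every Archimedean place, so discarding them cannot raise
the height: `h(β n) ≤ λ h(x n)` (`IsBalanced.exists_logHeight₁_div_le`). The λ-th roots of the `β n`
are the required factors, and the remaining quotient is a unit. -/

open NumberField Height Module

/-! ### Infinite places in extensions -/

section InfinitePlaces

variable {F : Type*} [Field F] [NumberField F]

theorem prod_infinitePlace_pow_mult {M : Type*} [CommMonoid M] (f : InfinitePlace F → M) :
    ∏ v : InfinitePlace F, f v ^ v.mult = ∏ φ : F →+* ℂ, f (.mk φ) := by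
  classical
  rw [← Finset.prod_fiberwise Finset.univ InfinitePlace.mk]
  refine Finset.prod_congr rfl fun v _ ↦ ?_
  rw [Finset.prod_congr rfl fun φ hφ ↦ congrArg f (Finset.mem_filter.mp hφ).2,
    Finset.prod_const, InfinitePlace.card_filter_mk_eq]

theorem card_filter_comp_algebraMap_eq {L : Type*} [Field L] [NumberField L] [Algebra F L]
    [DecidableEq (F →+* ℂ)] (ψ : F →+* ℂ) :
    (Finset.univ.filter fun φ : L →+* ℂ ↦ φ.comp (algebraMap F L) = ψ).card = finrank F L := by
  let := ψ.toAlgebra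
  have : FiniteDimensional F L := FiniteDimensional.right ℚ F L
  rw [← AlgHom.card F L ℂ, ← Finset.card_univ]
  symm
  refine Finset.card_bij (fun σ _ ↦ σ.toRingHom) (fun σ _ ↦ ?_) (fun σ _ τ _ h ↦ ?_)
    fun φ hφ ↦ ?_
  · exact Finset.mem_filter.mpr ⟨Finset.mem_univ _, σ.comp_algebraMap⟩
  · exact AlgHom.ext fun x ↦ RingHom.congr_fun h x
  · refine ⟨⟨φ, fun x ↦ ?_⟩, Finset.mem_univ _, rfl⟩
    exact RingHom.congr_fun (Finset.mem_filter.mp hφ).2 x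

theorem prod_infinitePlace_comap_pow_mult {L : Type*} [Field L] [NumberField L] [Algebra F L]
    {M : Type*} [CommMonoid M] (f : InfinitePlace F → M) :
    ∏ w : InfinitePlace L, f (w.comap (algebraMap F L)) ^ w.mult =
      (∏ v : InfinitePlace F, f v ^ v.mult) ^ finrank F L := by
  classical
  rw [prod_infinitePlace_pow_mult (fun w : InfinitePlace L ↦ f (w.comap (algebraMap F L))),
    prod_infinitePlace_pow_mult,
    ← Finset.prod_fiberwise Finset.univ fun φ : L →+* ℂ ↦ φ.comp (algebraMap F L),
    ← Finset.prod_pow]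
  refine Finset.prod_congr rfl fun ψ _ ↦ ?_
  rw [← card_filter_comp_algebraMap_eq (L := L) ψ, ← Finset.prod_const]
  refine Finset.prod_congr rfl fun φ hφ ↦ ?_
  rw [InfinitePlace.comap_mk, (Finset.mem_filter.mp hφ).2]

end InfinitePlaces

/-! ### Heights in integral coordinates and under field extension -/

section IntegralCoordinates

variable {F : Type*} [Field F] [NumberField F]

/-- The finite places contribute exactly the inverse norm of the ideal `(a, b)`, so multiplying by
that norm leaves the Archimedean factor. -/
theorem absNorm_mul_mulHeight_eq {a b : 𝓞 F} (hb : b ≠ 0) :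
    (Ideal.span {a, b}).absNorm * mulHeight ![(a : F), (b : F)] =
      ∏ v : InfinitePlace F, max (v a) (v b) ^ v.mult := by
  have hx : ![a, b] ≠ 0 := fun h ↦ hb (congrFun h 1)
  have hx' : ![(a : F), (b : F)] ≠ 0 := fun h ↦ hb (by simpa using congrFun h 1)
  have key := absNorm_mul_finprod_finitePlace_eq_one hx
  have hc (i : Fin 2) : ((![a, b] i : 𝓞 F) : F) = ![(a : F), (b : F)] i := by
    fin_cases i <;> rfl
  simp only [hc, Matrix.range_cons, Matrix.range_empty, Set.union_empty,
    Set.singleton_union] at key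
  rw [NumberField.mulHeight_eq hx', mul_left_comm, key, mul_one]
  refine Finset.prod_congr rfl fun v _ ↦ ?_
  congr 1
  refine le_antisymm (ciSup_le fun i ↦ ?_) (max_le ?_ ?_)
  · fin_cases i <;> simp
  · exact Finite.le_ciSup_of_le 0 (by simp)
  · exact Finite.le_ciSup_of_le 1 (by simp)

/-- In integral coordinates both the ideal norm and the Archimedean product are raised to the power
`[L : F]`, so no analysis of how finite places split is needed. -/
theorem mulHeight₁_algebraMap {L : Type*} [Field L] [NumberField L] [Algebra F L] (x : F) :
    mulHeight₁ (algebraMap F L x) = mulHeight₁ x ^ finrank F L := by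
  obtain ⟨a, b, hb, rfl⟩ := IsFractionRing.div_surjective (A := 𝓞 F) x
  have hb0 : b ≠ 0 := nonZeroDivisors.ne_zero hb
  have hb1 : algebraMap (𝓞 F) (𝓞 L) b ≠ 0 := by
    simpa using hb0
  have e (c : 𝓞 F) : algebraMap F L (algebraMap (𝓞 F) F c) =
      algebraMap (𝓞 L) L (algebraMap (𝓞 F) (𝓞 L) c) := by
    rw [← IsScalarTower.algebraMap_apply, ← IsScalarTower.algebraMap_apply]
  have h1 := absNorm_mul_mulHeight_eq (a := a) hb0
  have h2 := absNorm_mul_mulHeight_eq (a := algebraMap (𝓞 F) (𝓞 L) a) hb1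
  have hspan : Ideal.span {algebraMap (𝓞 F) (𝓞 L) a, algebraMap (𝓞 F) (𝓞 L) b} =
      (Ideal.span {a, b}).map (algebraMap (𝓞 F) (𝓞 L)) := by
    rw [Ideal.map_span, Set.image_pair]
  have hrank : finrank (𝓞 F) (𝓞 L) = finrank F L :=
    (IsFractionRing.finrank_eq (𝓞 F) F (𝓞 L) L).symm
  rw [hspan, Ideal.absNorm_algebraMap, hrank] at h2
  have h3 : ∏ w : InfinitePlace L, max (w (algebraMap (𝓞 F) (𝓞 L) a))
      (w (algebraMap (𝓞 F) (𝓞 L) b)) ^ w.mult =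
      (∏ v : InfinitePlace F, max (v a) (v b) ^ v.mult) ^ finrank F L := by
    rw [← prod_infinitePlace_comap_pow_mult (L := L) fun v : InfinitePlace F ↦ max (v a) (v b)]
    simp only [InfinitePlace.comap_apply, RingOfIntegers.coe_eq_algebraMap, e]
  rw [h3, ← h1, mul_pow, Nat.cast_pow] at h2
  rw [map_div₀, mulHeight₁_div_eq_mulHeight, mulHeight₁_div_eq_mulHeight, e, e]
  refine mul_left_cancel₀ (pow_ne_zero _ ?_) h2
  rw [Nat.cast_ne_zero, Ne, Ideal.absNorm_eq_zero_iff, Ideal.span_eq_bot]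
  exact fun h ↦ hb0 (h b (by simp))

end IntegralCoordinates

/-! ### The absolute height -/

section AbsoluteHeight

variable {Ω : Type*} [Field Ω] [CharZero Ω] {F : Type*} [Field F] [NumberField F]

/-- The absolute height can be computed in any number field containing the element. -/
theorem absLogHeight₁_map (φ : F →+* Ω) (x : F) :
    absLogHeight₁ (φ x) = logHeight₁ x / finrank ℚ F := by
  have hx : IsIntegral ℚ (φ x) :=
    (Algebra.IsIntegral.isIntegral (R := ℚ) x).map φ.toRatAlgHom
  have : FiniteDimensional ℚ ℚ⟮φ x⟯ := IntermediateField.adjoin.finiteDimensional hx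
  have : NumberField ℚ⟮φ x⟯ := {}
  -- This root of the minimal polynomial of `φ x` embeds `ℚ⟮φ x⟯` into `F`.
  have hroot : x ∈ (minpoly ℚ (φ x)).aroots F := by
    rw [Polynomial.mem_aroots]
    refine ⟨minpoly.ne_zero hx, φ.injective ?_⟩
    have := minpoly.aeval ℚ (φ x)
    rw [map_zero, ← this]
    exact (Polynomial.aeval_algHom_apply φ.toRatAlgHom x _).symm
  let ψ : ℚ⟮φ x⟯ →ₐ[ℚ] F :=
    (IntermediateField.algHomAdjoinIntegralEquiv ℚ hx).symm ⟨x, hroot⟩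
  have hψ : ψ (IntermediateField.AdjoinSimple.gen ℚ (φ x)) = x :=
    IntermediateField.algHomAdjoinIntegralEquiv_symm_apply_gen ℚ hx ⟨x, hroot⟩
  let : Algebra ℚ⟮φ x⟯ F := ψ.toRingHom.toAlgebra
  have h1 : mulHeight₁ x = mulHeight₁ (IntermediateField.AdjoinSimple.gen ℚ (φ x)) ^
      finrank ℚ⟮φ x⟯ F := by
    rw [← mulHeight₁_algebraMap]
    exact congrArg mulHeight₁ hψ.symm
  have : IsScalarTower ℚ ℚ⟮φ x⟯ F := IsScalarTower.of_algebraMap_eq fun q ↦ by simp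
  have hne : (finrank ℚ⟮φ x⟯ F : ℝ) ≠ 0 := by
    have : FiniteDimensional ℚ⟮φ x⟯ F := FiniteDimensional.right ℚ _ _
    exact_mod_cast finrank_pos.ne'
  rw [absLogHeight₁, absMulHeight₁, dif_pos hx, Real.log_rpow (mulHeight₁_pos _),
    logHeight₁_eq_log_mulHeight₁, h1, Real.log_pow, ← finrank_mul_finrank ℚ ℚ⟮φ x⟯ F,
    Nat.cast_mul]
  rw [mul_comm (finrank ℚ ℚ⟮φ x⟯ : ℝ), mul_div_mul_left _ _ hne, div_eq_inv_mul]

theorem exists_numberField_range_subset [Algebra.IsAlgebraic ℚ Ω] {ι : Type*} [Finite ι]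
    (y : ι → Ω) : ∃ E : IntermediateField ℚ Ω, NumberField E ∧ ∀ i, y i ∈ E := by
  refine ⟨IntermediateField.adjoin ℚ (Set.range y), ?_, fun i ↦
    IntermediateField.subset_adjoin _ _ ⟨i, rfl⟩⟩
  have : FiniteDimensional ℚ (IntermediateField.adjoin ℚ (Set.range y)) :=
    IntermediateField.finiteDimensional_adjoin fun x _ ↦ Algebra.IsIntegral.isIntegral x
  exact {}

theorem absLogHeight₁_prod_le [Algebra.IsAlgebraic ℚ Ω] {ι : Type*} [Fintype ι] (y : ι → Ω) :
    absLogHeight₁ (∏ i, y i) ≤ ∑ i, absLogHeight₁ (y i) := by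
  obtain ⟨E, _, hE⟩ := exists_numberField_range_subset y
  have h (i) : absLogHeight₁ (y i) = logHeight₁ (⟨y i, hE i⟩ : E) / finrank ℚ E :=
    absLogHeight₁_map (algebraMap E Ω) ⟨y i, hE i⟩
  have h' : ∏ i, y i = algebraMap E Ω (∏ i, ⟨y i, hE i⟩) := by
    rw [map_prod]; rfl
  rw [h', absLogHeight₁_map, Finset.sum_congr rfl fun i _ ↦ h i, ← Finset.sum_div]
  gcongr
  exact logHeight₁_prod_le _ _

theorem absLogHeight₁_pow [Algebra.IsAlgebraic ℚ Ω] (y : Ω) (n : ℕ) :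
    absLogHeight₁ (y ^ n) = n * absLogHeight₁ y := by
  obtain ⟨E, _, hE⟩ := exists_numberField_range_subset fun _ : Unit ↦ y
  have h := absLogHeight₁_map (algebraMap E Ω) ⟨y, hE ()⟩
  have h' := absLogHeight₁_map (algebraMap E Ω) (⟨y, hE ()⟩ ^ n)
  rw [map_pow, logHeight₁_pow, mul_div_assoc, ← h] at h'
  exact h'

end AbsoluteHeight
-- Relative norms
section RelativeNorm

variable {Ω : Type*} [Field Ω] [CharZero Ω] [Algebra.IsAlgebraic ℚ Ω]
  {K : Type*} [Field K] [NumberField K] [Algebra K Ω]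

/-- The height of the relative norm of `y` is at most `[K(y) : K]` times the height of `y`. -/
theorem logHeight₁_norm_gen_le [IsAlgClosed Ω] {y : Ω} (hy : IsIntegral K y) :
    logHeight₁ (Algebra.norm K (IntermediateField.AdjoinSimple.gen K y)) / finrank ℚ K ≤
      mahlerMeasureOver K y := by
  have : FiniteDimensional K K⟮y⟯ := IntermediateField.adjoin.finiteDimensional hy
  have : FiniteDimensional ℚ K⟮y⟯ := FiniteDimensional.trans ℚ K K⟮y⟯
  have : NumberField K⟮y⟯ := {}
  rw [← absLogHeight₁_map (algebraMap K Ω), Algebra.norm_eq_prod_embeddings]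
  refine (absLogHeight₁_prod_le _).trans_eq ?_
  -- Conjugates have equal height: both are images of the generator of `K⟮y⟯`.
  have h (σ : K⟮y⟯ →ₐ[K] Ω) :
      absLogHeight₁ (σ (IntermediateField.AdjoinSimple.gen K y)) = absLogHeight₁ y :=
    (absLogHeight₁_map σ.toRingHom _).trans (absLogHeight₁_map (algebraMap K⟮y⟯ Ω) _).symm
  rw [Finset.sum_congr rfl fun σ _ ↦ h σ, Finset.sum_const, Finset.card_univ, AlgHom.card,
    nsmul_eq_mul, mahlerMeasureOver]

/-- A factorization over an algebraic closure yields, by taking norms, a factorization of a power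
into powers of the norms of the factors. -/
theorem exists_pow_eq_prod_norm_gen_pow {ι : Type*} [Fintype ι] {α : K} {y : ι → Ω}
    (h : algebraMap K Ω α = ∏ i, y i) :
    ∃ D : ℕ, D ≠ 0 ∧ ∃ k : ι → ℕ, (∀ i, k i ≤ D) ∧
      α ^ D = ∏ i, Algebra.norm K (IntermediateField.AdjoinSimple.gen K (y i)) ^ k i := by
  have hint (x : Ω) : IsIntegral K x := (Algebra.IsIntegral.isIntegral (R := ℚ) x).tower_top
  let E := IntermediateField.adjoin K (Set.range y)
  have : FiniteDimensional K E :=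
    IntermediateField.finiteDimensional_adjoin fun x _ ↦ hint x
  have hE (i) : K⟮y i⟯ ≤ E := IntermediateField.adjoin.mono _ _ _ (by simp)
  let z (i : ι) : E := ⟨y i, IntermediateField.subset_adjoin _ _ ⟨i, rfl⟩⟩
  have hz : algebraMap K E α = ∏ i, z i := by
    apply (algebraMap E Ω).injective
    rw [← IsScalarTower.algebraMap_apply, h, map_prod]
    rfl
  let _ : ∀ i, Algebra K⟮y i⟯ E := fun i ↦
    (IntermediateField.inclusion (hE i)).toRingHom.toAlgebra
  have _ : ∀ i, IsScalarTower K K⟮y i⟯ E := fun i ↦ IsScalarTower.of_algebraMap_eq fun q ↦ rfl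
  have hmul (i) := finrank_mul_finrank K K⟮y i⟯ E
  refine ⟨finrank K E, finrank_pos.ne', fun i ↦ finrank K⟮y i⟯ E, fun i ↦ ?_, ?_⟩
  · exact Nat.le_of_dvd finrank_pos (Dvd.intro_left _ (hmul i))
  · rw [← Algebra.norm_algebraMap, hz, map_prod]
    refine Finset.prod_congr rfl fun i _ ↦ ?_
    have : FiniteDimensional K K⟮y i⟯ := IntermediateField.adjoin.finiteDimensional (hint _)
    rw [← Algebra.norm_norm (S := K⟮y i⟯), ← map_pow, ← Algebra.norm_algebraMap]
    rfl

end RelativeNorm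

/-- Meant for ideals; trivial units turn association into equality. -/
theorem exists_dvd_eq_prod_of_dvd_prod {M : Type*} [CommMonoid M] [DecompositionMonoid M]
    [Subsingleton Mˣ] {ι : Type*} (s : Finset ι) (f : ι → M) {a : M} (h : a ∣ ∏ i ∈ s, f i) :
    ∃ g : ι → M, (∀ i ∈ s, g i ∣ f i) ∧ a = ∏ i ∈ s, g i := by
  classical
  induction s using Finset.induction_on generalizing a with
  | empty => exact ⟨1, by simp, by simpa [← isUnit_iff_dvd_one] using h⟩
  | insert j s hj ih =>
    rw [Finset.prod_insert hj] at h
    obtain ⟨a₁, a₂, h₁, h₂, rfl⟩ := exists_dvd_and_dvd_of_dvd_mul h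
    obtain ⟨g, hg, rfl⟩ := ih h₂
    refine ⟨Function.update g j a₁, fun i hi ↦ ?_, ?_⟩
    · rcases Finset.mem_insert.mp hi with rfl | hi
      · simpa using h₁
      · rw [Function.update_of_ne (ne_of_mem_of_not_mem hi hj)]
        exact hg i hi
    · rw [Finset.prod_insert hj, Function.update_self]
      congr 1
      exact Finset.prod_congr rfl fun i hi ↦
        (Function.update_of_ne (ne_of_mem_of_not_mem hi hj) _ _).symm

/-! ### Ideals in a balanced field -/

section

variable {K : Type*} [Field K] [NumberField K]

theorem exists_span_eq_pow_classNumber {I : Ideal (𝓞 K)} (hI : I ≠ 0) :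
    ∃ a : 𝓞 K, a ≠ 0 ∧ Ideal.span {a} = I ^ classNumber K := by
  have hI' := mem_nonZeroDivisors_of_ne_zero hI
  have h : ClassGroup.mk0 ⟨I ^ classNumber K, pow_mem hI' _⟩ = 1 := by
    rw [← SubmonoidClass.mk_pow _ hI', map_pow, classNumber, pow_card_eq_one]
  obtain ⟨a, ha⟩ := ((ClassGroup.mk0_eq_one_iff _).mp h).principal
  refine ⟨a, ?_, ha.symm⟩
  rintro rfl
  exact pow_ne_zero _ hI (by simpa using ha)

theorem IsBalanced.exists_span_eq_pow_classNumber_one_le (hK : IsBalanced K) {I : Ideal (𝓞 K)}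
    (hI : I ≠ 0) : ∃ a : 𝓞 K, a ≠ 0 ∧ Ideal.span {a} = I ^ classNumber K ∧
      ∀ v : InfinitePlace K, 1 ≤ v (a : K) := by
  obtain ⟨a, ha, h⟩ := exists_span_eq_pow_classNumber hI
  obtain ⟨u, hu⟩ := hK a ha
  refine ⟨u * a, mul_ne_zero u.ne_zero ha, ?_, fun v ↦ by simpa using hu v⟩
  rw [Ideal.span_singleton_mul_left_unit u.isUnit, h]

/-- The numerator and denominator ideals of a nonzero element of a number field. -/
theorem exists_coprime_ideals {x : K} (hx : x ≠ 0) :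
    ∃ (X Y : Ideal (𝓞 K)) (r s : 𝓞 K), X ≠ 0 ∧ Y ≠ 0 ∧ IsRelPrime X Y ∧ r ≠ 0 ∧ s ≠ 0 ∧
      x = r / s ∧ Ideal.span {r} * Y = Ideal.span {s} * X := by
  obtain ⟨r, s, hs, rfl⟩ := IsFractionRing.div_surjective (A := 𝓞 K) x
  have hs0 : s ≠ 0 := nonZeroDivisors.ne_zero hs
  have hr0 : r ≠ 0 := by rintro rfl; simp at hx
  have hs1 : Ideal.span {s} ≠ 0 := by simpa using hs0
  have hr1 : Ideal.span {r} ≠ 0 := by simpa using hr0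
  obtain ⟨X, Y, G, h, hX, hY⟩ :=
    UniqueFactorizationMonoid.exists_reduced_factors' (Ideal.span {r}) _ hs1
  refine ⟨X, Y, r, s, ?_, ?_, h, hr0, hs0, rfl, ?_⟩
  · exact right_ne_zero_of_mul (hX ▸ hr1)
  · exact right_ne_zero_of_mul (hY ▸ hs1)
  · rw [← hX, ← hY]; ring

/-- Coprimality makes the right side purely Archimedean. The left side is at most its own
Archimedean product, which `c` and `d` can only enlarge. -/
theorem mulHeight_le_of_mul_of_isRelPrime {a b c d : 𝓞 K} (hb : b ≠ 0) (hd : d ≠ 0)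
    (hcop : IsRelPrime (Ideal.span {c * a}) (Ideal.span {d * b}))
    (hc1 : ∀ v : InfinitePlace K, 1 ≤ v (c : K)) (hd1 : ∀ v : InfinitePlace K, 1 ≤ v (d : K)) :
    mulHeight ![(a : K), (b : K)] ≤ mulHeight ![((c * a : 𝓞 K) : K), ((d * b : 𝓞 K) : K)] := by
  have h1 := absNorm_mul_mulHeight_eq (a := a) hb
  have h2 := absNorm_mul_mulHeight_eq (a := c * a) (mul_ne_zero hd hb)
  have htop : Ideal.span {c * a, d * b} = ⊤ := by
    refine Ideal.isUnit_iff.mp (hcop ?_ ?_) <;> rw [Ideal.dvd_iff_le] <;>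
      exact Ideal.span_mono (by simp)
  rw [htop, Ideal.absNorm_top, Nat.cast_one, one_mul] at h2
  rw [h2]
  have hN : (1 : ℝ) ≤ (Ideal.span {a, b}).absNorm := by
    rw [Nat.one_le_cast, Nat.one_le_iff_ne_zero, Ne, Ideal.absNorm_eq_zero_iff, Ideal.span_eq_bot]
    exact fun h ↦ hb (h b (by simp))
  calc mulHeight ![(a : K), (b : K)]
      ≤ (Ideal.span {a, b}).absNorm * mulHeight ![(a : K), (b : K)] :=
        le_mul_of_one_le_left (mulHeight_pos _).le hN
    _ = ∏ v : InfinitePlace K, max (v a) (v b) ^ v.mult := h1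
    _ ≤ _ := by
      refine Finset.prod_le_prod (fun v _ ↦ by positivity) fun v _ ↦ ?_
      simp only [map_mul]
      gcongr
      · exact le_mul_of_one_le_left (apply_nonneg v _) (hc1 v)
      · exact le_mul_of_one_le_left (apply_nonneg v _) (hd1 v)

/-- Over a balanced field, divisors of the numerator and denominator ideals of `x` have powers
generated by elements whose quotient has height at most that of a power of `x`. -/
theorem IsBalanced.exists_logHeight₁_div_le (hK : IsBalanced K) {X Y : Ideal (𝓞 K)} {r s : 𝓞 K}
    (hX : X ≠ 0) (hY : Y ≠ 0) (hXY : IsRelPrime X Y) (hs : s ≠ 0)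
    (h : Ideal.span {r} * Y = Ideal.span {s} * X) {A B : Ideal (𝓞 K)} (hA : A ∣ X) (hB : B ∣ Y) :
    ∃ a b : 𝓞 K, a ≠ 0 ∧ b ≠ 0 ∧ Ideal.span {a} = A ^ classNumber K ∧
      Ideal.span {b} = B ^ classNumber K ∧
      logHeight₁ ((a : K) / b) ≤ classNumber K * logHeight₁ ((r : K) / s) := by
  obtain ⟨C, rfl⟩ := hA
  obtain ⟨D, rfl⟩ := hB
  obtain ⟨a, ha0, ha⟩ := exists_span_eq_pow_classNumber (left_ne_zero_of_mul hX)
  obtain ⟨b, hb0, hb⟩ := exists_span_eq_pow_classNumber (left_ne_zero_of_mul hY)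
  -- Balancedness is needed only for the cofactors `C` and `D`.
  obtain ⟨c, hc0, hc, hc1⟩ := hK.exists_span_eq_pow_classNumber_one_le (right_ne_zero_of_mul hX)
  obtain ⟨d, hd0, hd, hd1⟩ := hK.exists_span_eq_pow_classNumber_one_le (right_ne_zero_of_mul hY)
  -- The resulting unit is absorbed into `a`, so that `c * a / (d * b)` is exactly `(r / s) ^ λ`.
  have hassoc : Associated (s ^ classNumber K * (c * a)) (r ^ classNumber K * (d * b)) := by
    rw [← Ideal.span_singleton_eq_span_singleton]
    simp only [← Ideal.span_singleton_mul_span_singleton, ← Ideal.span_singleton_pow, ha, hb, hc,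
      hd, ← mul_pow]
    rw [mul_comm C, mul_comm D, h]
  obtain ⟨u, hu⟩ := hassoc
  have ha' : Ideal.span {a * (u : 𝓞 K)} = A ^ classNumber K := by
    rw [Ideal.span_singleton_mul_right_unit u.isUnit, ha]
  refine ⟨a * u, b, mul_ne_zero ha0 u.ne_zero, hb0, ha', hb, ?_⟩
  have hcop : IsRelPrime (Ideal.span {c * (a * u)}) (Ideal.span {d * b}) := by
    rw [← Ideal.span_singleton_mul_span_singleton c, ← Ideal.span_singleton_mul_span_singleton d,
      ha', hb, hc, hd, ← mul_pow, ← mul_pow, mul_comm C, mul_comm D]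
    exact hXY.pow
  have key := mulHeight_le_of_mul_of_isRelPrime hb0 hd0 hcop hc1 hd1
  have hquot : ((c * (a * u) : 𝓞 K) : K) / ((d * b : 𝓞 K) : K) =
      ((r : K) / s) ^ classNumber K := by
    have hs' : (s : K) ≠ 0 := by simpa using hs
    have hdb : ((d * b : 𝓞 K) : K) ≠ 0 := by simpa using mul_ne_zero hd0 hb0
    rw [div_pow, div_eq_div_iff hdb (pow_ne_zero _ hs')]
    have := congrArg (algebraMap (𝓞 K) K) hu
    simp only [map_mul, map_pow] at this ⊢
    linear_combination this
  rw [← mulHeight₁_div_eq_mulHeight, ← mulHeight₁_div_eq_mulHeight, hquot] at key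
  rw [← logHeight₁_pow]
  exact Real.log_le_log (mulHeight₁_pos _) key

/-- A multiplicative relation `α ^ D = ∏ x i ^ k i` with `k i ≤ D` in a balanced field of class
number `λ` allows to write `α ^ λ`, up to a unit, as a product of elements `β i` with
`h (β i) ≤ λ h (x i)`. -/
theorem IsBalanced.exists_pow_classNumber_eq_unit_mul_prod (hK : IsBalanced K) {α : K}
    (hα : α ≠ 0) {ι : Type*} [Fintype ι] {x : ι → K} (hx : ∀ i, x i ≠ 0) {D : ℕ} (hD : D ≠ 0)
    {k : ι → ℕ} (hk : ∀ i, k i ≤ D) (h : α ^ D = ∏ i, x i ^ k i) :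
    ∃ β : ι → K, (∀ i, β i ≠ 0) ∧
      (∀ i, logHeight₁ (β i) ≤ classNumber K * logHeight₁ (x i)) ∧
      ∃ u : (𝓞 K)ˣ, α ^ classNumber K = (u : 𝓞 K) * ∏ i, β i := by
  obtain ⟨A, B, r, s, -, -, hAB, -, hs, hα', hrs⟩ := exists_coprime_ideals hα
  choose X Y p q hX hY hXY hp hq hx' hpq using fun i ↦ exists_coprime_ideals (hx i)
  have hs' : (s : K) ≠ 0 := by simpa using hs
  have hq' (i) : (q i : K) ≠ 0 := by simpa using hq i
  have hcross : r ^ D * ∏ i, q i ^ k i = s ^ D * ∏ i, p i ^ k i := by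
    apply RingOfIntegers.coe_injective
    have hprod : ∏ i, (q i : K) ^ k i ≠ 0 :=
      Finset.prod_ne_zero_iff.mpr fun i _ ↦ pow_ne_zero _ (hq' i)
    simp only [hx', hα', div_pow, Finset.prod_div_distrib] at h
    rw [div_eq_div_iff (pow_ne_zero _ hs') hprod] at h
    simp only [map_mul, map_pow, map_prod]
    rw [h, mul_comm]
  have hideal : A ^ D * ∏ i, Y i ^ k i = B ^ D * ∏ i, X i ^ k i := by
    have h1 := congrArg (fun z ↦ Ideal.span {z}) hcross
    simp only [← Ideal.span_singleton_mul_span_singleton, ← Ideal.span_singleton_pow,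
      ← Ideal.prod_span_singleton] at h1
    have h2 : Ideal.span {r} ^ D * B ^ D = Ideal.span {s} ^ D * A ^ D := by
      rw [← mul_pow, hrs, mul_pow]
    have h3 : (∏ i, Ideal.span {p i} ^ k i) * ∏ i, Y i ^ k i =
        (∏ i, Ideal.span {q i} ^ k i) * ∏ i, X i ^ k i := by
      rw [← Finset.prod_mul_distrib, ← Finset.prod_mul_distrib]
      exact Finset.prod_congr rfl fun i _ ↦ by rw [← mul_pow, hpq, mul_pow]
    have hne : Ideal.span {s} ^ D * ∏ i, Ideal.span {p i} ^ k i ≠ 0 :=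
      mul_ne_zero (pow_ne_zero _ (by simpa using hs)) <|
        Finset.prod_ne_zero_iff.mpr fun i _ ↦ pow_ne_zero _ (by simpa using hp i)
    refine mul_left_cancel₀ hne ?_
    calc _ = (Ideal.span {s} ^ D * A ^ D) *
          ((∏ i, Ideal.span {p i} ^ k i) * ∏ i, Y i ^ k i) := by ring
      _ = (Ideal.span {r} ^ D * ∏ i, Ideal.span {q i} ^ k i) *
          (B ^ D * ∏ i, X i ^ k i) := by rw [← h2, h3]; ring
      _ = _ := by rw [h1]
  -- As `k i ≤ D`, each exponent can be raised to `D`, and then `D`-th roots of the divisibility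
  -- taken.
  have hpow {I : Ideal (𝓞 K)} {J : ι → Ideal (𝓞 K)} (hIJ : I ^ D ∣ ∏ i, J i ^ k i) :
      I ∣ ∏ i, J i := by
    rw [← UniqueFactorizationMonoid.pow_dvd_pow_iff_dvd hD, ← Finset.prod_pow]
    exact hIJ.trans (Finset.prod_dvd_prod_of_dvd _ _ fun i _ ↦ pow_dvd_pow _ (hk i))
  -- Coprimality of `A` and `B` removes the factor `B ^ D`.
  obtain ⟨A', hA', rfl⟩ := exists_dvd_eq_prod_of_dvd_prod _ _
    (hpow (hAB.pow.dvd_of_dvd_mul_left (Dvd.intro _ hideal)))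
  obtain ⟨B', hB', rfl⟩ := exists_dvd_eq_prod_of_dvd_prod _ _
    (hpow (hAB.symm.pow.dvd_of_dvd_mul_left (Dvd.intro _ hideal.symm)))
  choose a b ha0 hb0 ha hb hab using fun i ↦ hK.exists_logHeight₁_div_le (hX i) (hY i) (hXY i)
    (hq i) (hpq i) (hA' i (Finset.mem_univ i)) (hB' i (Finset.mem_univ i))
  have ha0' (i) : (a i : K) ≠ 0 := by simpa using ha0 i
  have hb0' (i) : (b i : K) ≠ 0 := by simpa using hb0 i
  refine ⟨fun i ↦ (a i : K) / b i, fun i ↦ div_ne_zero (ha0' i) (hb0' i),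
    fun i ↦ hx' i ▸ hab i, ?_⟩
  have hassoc : Associated (s ^ classNumber K * ∏ i, a i) (r ^ classNumber K * ∏ i, b i) := by
    rw [← Ideal.span_singleton_eq_span_singleton]
    simp only [← Ideal.span_singleton_mul_span_singleton, ← Ideal.span_singleton_pow,
      ← Ideal.prod_span_singleton, ha, hb, Finset.prod_pow]
    rw [← mul_pow, ← mul_pow, hrs]
  obtain ⟨u, hu⟩ := hassoc
  refine ⟨u, ?_⟩
  have hprod : ∏ i, (b i : K) ≠ 0 := Finset.prod_ne_zero_iff.mpr fun i _ ↦ hb0' i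
  have := congrArg (algebraMap (𝓞 K) K) hu
  simp only [map_mul, map_pow, map_prod] at this
  rw [hα', div_pow, Finset.prod_div_distrib, ← mul_div_assoc,
    div_eq_div_iff (pow_ne_zero _ hs') hprod]
  linear_combination -this

end

/-! ### The unit factor and the conclusion -/

theorem isUnit_integralClosure_of_pow_eq {K Ω : Type*} [Field K] [NumberField K] [Field Ω]
    [Algebra K Ω] {x : Ω} {n : ℕ} (hn : 0 < n) {u : (𝓞 K)ˣ}
    (h : x ^ n = algebraMap K Ω ((u : 𝓞 K) : K)) :
    ∃ w : (integralClosure ℤ Ω)ˣ, ((w : integralClosure ℤ Ω) : Ω) = x := by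
  have hint (z : 𝓞 K) : IsIntegral ℤ (algebraMap K Ω z) :=
    z.isIntegral_coe.map (algebraMap K Ω).toIntAlgHom
  have hx : x ≠ 0 := by
    rintro rfl
    rw [zero_pow hn.ne', eq_comm, map_eq_zero] at h
    simp at h
  have h' : x⁻¹ ^ n = algebraMap K Ω ((u⁻¹ : (𝓞 K)ˣ) : 𝓞 K) := by
    rw [inv_pow, h]
    refine inv_eq_of_mul_eq_one_right ?_
    rw [← map_mul, ← map_mul, Units.mul_inv, map_one, map_one]
  -- Both `x` and its inverse are integral, since their `n`-th powers are.
  exact ⟨⟨⟨x, .of_pow hn (h ▸ hint _)⟩, ⟨x⁻¹, .of_pow hn (h' ▸ hint _)⟩,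
    Subtype.ext (mul_inv_cancel₀ hx), Subtype.ext (inv_mul_cancel₀ hx)⟩, rfl⟩

theorem theorem3p3 {Qbar : Type*} [Field Qbar] [CharZero Qbar] [IsAlgClosed Qbar]
    [Algebra.IsAlgebraic ℚ Qbar]
    {K : Type*} [Field K] [NumberField K] [Algebra K Qbar]
    (hK : IsBalanced K) (α : K) (hα : α ≠ 0)
    (N : ℕ) (a : Fin N → Qbar) (ha : algebraMap K Qbar α = ∏ n, a n) :
    ∃ γ : Fin (N + 1) → Qbar,
      algebraMap K Qbar α = ∏ n, γ n ∧
      (∃ u : (integralClosure ℤ Qbar)ˣ, ((u : integralClosure ℤ Qbar) : Qbar) = γ 0) ∧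
      (∀ n, γ n ^ NumberField.classNumber K ∈ Set.range (algebraMap K Qbar)) ∧
      (∀ n : Fin N, NumberField.absLogHeight₁ (γ n.succ) ≤ mahlerMeasureOver K (a n)) := by
  have hint (x : Qbar) : IsIntegral K x := (Algebra.IsIntegral.isIntegral (R := ℚ) x).tower_top
  have hcl := classNumber_pos K
  have ha0 : ∏ n, a n ≠ 0 := ha ▸ (map_ne_zero _).mpr hα
  obtain ⟨D, hD, k, hk, hrel⟩ := exists_pow_eq_prod_norm_gen_pow ha
  have hnorm (n) : Algebra.norm K (IntermediateField.AdjoinSimple.gen K (a n)) ≠ 0 := by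
    have : FiniteDimensional K K⟮a n⟯ := IntermediateField.adjoin.finiteDimensional (hint _)
    rw [Algebra.norm_ne_zero_iff]
    intro h
    exact Finset.prod_ne_zero_iff.mp ha0 n (Finset.mem_univ n) (congrArg Subtype.val h)
  obtain ⟨β, hβ, hβle, u, hu⟩ := hK.exists_pow_classNumber_eq_unit_mul_prod hα hnorm hD hk hrel
  choose g hg using fun n ↦ IsAlgClosed.exists_pow_nat_eq (algebraMap K Qbar (β n)) hcl
  have hg0 : ∏ n, g n ≠ 0 := Finset.prod_ne_zero_iff.mpr fun n _ h ↦ by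
    have := hg n
    rw [h, zero_pow hcl.ne', eq_comm, map_eq_zero] at this
    exact hβ n this
  have hγ₀ : (algebraMap K Qbar α / ∏ n, g n) ^ classNumber K =
      algebraMap K Qbar ((u : 𝓞 K) : K) := by
    rw [div_pow, div_eq_iff (pow_ne_zero _ hg0), ← map_pow, hu, map_mul, map_prod,
      ← Finset.prod_pow]
    simp only [hg]
  refine ⟨Fin.cons (algebraMap K Qbar α / ∏ n, g n) g, ?_, ?_, ?_, fun n ↦ ?_⟩
  · rw [Fin.prod_cons, div_mul_cancel₀ _ hg0]
  · rw [Fin.cons_zero]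
    exact isUnit_integralClosure_of_pow_eq hcl hγ₀
  · refine Fin.cases ⟨_, hγ₀.symm⟩ fun n ↦ ⟨β n, (hg n).symm⟩
  · rw [Fin.cons_succ]
    refine le_trans ?_ (logHeight₁_norm_gen_le (hint (a n)))
    have h1 := absLogHeight₁_pow (g n) (classNumber K)
    rw [hg, absLogHeight₁_map] at h1
    have hcl' : (0 : ℝ) < classNumber K := Nat.cast_pos.mpr hcl
    refine le_of_mul_le_mul_left ?_ hcl'
    rw [← h1, ← mul_div_assoc]
    gcongr
    exact hβle n
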